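/- **Setting.** Candidates are identified by names from a countably infinite supply. An election $(C,V)$ consists of a finite set $C$ of candidates and a finite multiset $V$ of linear orders over $C$; when a subset $D$ of the candidates competes, the votes are masked down to $D$. An election system $\mathcal E$ maps every election $(C,V)$ to a (possibly empty) subset of $C$, the winners. A standard control type is a triple of a goal (CC constructive, DC destructive), one of eleven actions, and a winner model (UW: "is the unique winner"; NUW: "is a winner"); there are 44. For CC the question is whether the action can be exercised so that the focus candidate $p\in C$ is a winner (in the winner model) of the resulting election; for DC, so that $p$ is not one. Inputs and actions are as follows. * AC: $(C,A,V,p,k)$ with $C\cap A=\emptyset$ and $V$ over $C\cup A$: add at most $k$ candidates of $A$. UAC: the same without the limit $k$. * DC (as action): $(C,V,p,k)$: delete at most $k$ candidates other than $p$. DV: $(C,V,p,k)$: delete at most $k$ votes. * AV: $(C,V,W,p,k)$ with $W$ over $C$: add at most $k$ votes of $W$. * PV-TE/TP: $(C,V,p)$: partition $V=V_1\cup V_2$; the survivors of $(C,V_1)$ and of $(C,V_2)$ form the final round. PC-TE/TP: $(C,V,p)$: partition $C=C_1\cup C_2$; the survivors of $(C_1,V)$ together with all of $C_2$ form the final round.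 RPC-TE/TP: the same, with the survivors of $(C_1,V)$ and of $(C_2,V)$. Final rounds use all of $V$. Under TP (ties promote) all winners of a subelection survive; under TE (ties eliminate) only a unique winner does. Parts may be empty. Two types are compatible if their inputs have the same fields. Let $\mathcal E\text{-}\mathcal T$ be the set of yes-instances and, for an input $\tilde I$ without focus candidate, let $f_{\mathcal E\text{-}\mathcal T}(\tilde I)$ be the set of candidates $c$ for which $\tilde I$ with focus candidate $c$ is in $\mathcal E\text{-}\mathcal T$. For a fixed $\mathcal E$, compatible types $\mathcal T,\mathcal T'$ collapse if $\mathcal E\text{-}\mathcal T=\mathcal E\text{-}\mathcal T'$ and otherwise separate; $\mathcal T\subseteq\mathcal T'$ holds if $f_{\mathcal E\text{-}\mathcal T}(\tilde I)\subseteq f_{\mathcal E\text{-}\mathcal T'}(\tilde I)$ for all $\tilde I$, and $\mathcal T\subsetneq\mathcal T'$ if in addition $f_{\mathcal E\text{-}\mathcal T'}(\tilde I)\setminus f_{\mathcal E\text{-}\mathcal T}(\tilde I)\ne\emptyset$ for some $\tilde I$; they are incomparable if they separate and neither $\mathcal T\subsetneq\mathcal T'$ nor $\mathcal T'\subsetneq\mathcal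 T$. In the general case, $\mathcal T,\mathcal T'$ collapse if they collapse for every $\mathcal E$, and otherwise separate; $\mathcal T\subsetneq\mathcal T'$ if $\mathcal T\subseteq\mathcal T'$ for every $\mathcal E$ and $f_{\mathcal E\text{-}\mathcal T'}(\tilde I)\setminus f_{\mathcal E\text{-}\mathcal T}(\tilde I)\ne\emptyset$ for some $\mathcal E$ and $\tilde I$; they are incomparable if they are incomparable for some $\mathcal E$. **Theorem.** The 44 standard control types have exactly 322 unordered pairs of distinct compatible types. In the general case (all election systems whose votes are linear orders): 1. Exactly seven of these pairs collapse: the six pairs among DC-RPC-TE-NUW, DC-RPC-TE-UW, DC-PC-TE-NUW, DC-PC-TE-UW, and the pair DC-RPC-TP-NUW, DC-PC-TP-NUW. The other 315 pairs separate. 2. Of the separating pairs, exactly 38 are strict containments, namely: CC-$a$-UW $\subsetneq$ CC-$a$-NUW for each of the eleven actions $a$; DC-$a$-NUW $\subsetneq$ DC-$a$-UW for each action $a$ other than RPC-TE and PC-TE; DC-$x$-TP-NUW $\subsetneq$ DC-$y$-TP-UW for all $x,y\in\{\mathrm{RPC},\mathrm{PC}\}$; and DC-$x$-TP-$m$ $\subsetneq$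 DC-$y$-TE-$m'$ for all $x,y\in\{\mathrm{RPC},\mathrm{PC}\}$ and $m,m'\in\{\mathrm{UW},\mathrm{NUW}\}$. 3. The remaining 277 pairs are incomparable. 4. All of this is witnessed by plurality (the winners are the candidates with the most first places), which is candidate-neutral: each pair that separates in general separates for plurality, each general strict containment is strict for plurality, and each pair that is incomparable in general is incomparable for plurality. -/

import Mathlib

/-!
# Electoral control types, collapses and separations

Candidates are identified by names. A vote is a linear order over the candidates, presented as the
list of the candidates from the most to the least preferred one.
-/

/-- Candidate names (a countably infinite supply, as for finite strings). -/
abbrev Candidate := ℕ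

/-- A linear order over `C`, written as a list: every candidate of `C`, each exactly once, from the
most preferred to the least preferred. -/
def IsRanking (C : Finset Candidate) (v : List Candidate) : Prop :=
  v.Nodup ∧ ∀ c, c ∈ v ↔ c ∈ C

/-- Rankings of `C` are the same thing as linear orders (complete, transitive, antisymmetric
relations) on `C`: for each linear order there is exactly one ranking that lists the candidates
of `C` in that order. -/
theorem existsUnique_ranking (C : Finset Candidate) (r : C → C → Prop)
    [IsTrans C r] [Std.Antisymm r] [Std.Total r] :
    ∃! v : List Candidate, IsRanking C v ∧
      v.Pairwise (fun a b => ∀ (ha : a ∈ C) (hb : b ∈ C), r ⟨a, ha⟩ ⟨b, hb⟩) := by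
  classical
  have hs : (((Finset.univ : Finset C).sort r).map Subtype.val).Pairwise
      (fun a b => ∀ (ha : a ∈ C) (hb : b ∈ C), r ⟨a, ha⟩ ⟨b, hb⟩) := by
    rw [List.pairwise_map]
    exact (Finset.pairwise_sort (Finset.univ : Finset C) r).imp (fun hab _ _ => hab)
  have hd : (((Finset.univ : Finset C).sort r).map Subtype.val).Nodup :=
    (Finset.sort_nodup _ _).map Subtype.val_injective
  refine ⟨((Finset.univ : Finset C).sort r).map Subtype.val, ⟨⟨hd, fun c => by simp⟩, hs⟩, ?_⟩
  rintro w ⟨⟨hn, hm⟩, hp⟩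
  refine List.Perm.eq_of_pairwise ?_ hp hs ?_
  · intro a b ha hb h1 h2
    have ha1 := (hm a).1 ha
    have hb1 : b ∈ C := by
      obtain ⟨x, _, rfl⟩ := List.mem_map.1 hb
      exact x.2
    exact congrArg Subtype.val (antisymm (r := r) (h1 ha1 hb1) (h2 hb1 ha1))
  · rw [List.perm_ext_iff_of_nodup hn hd]
    intro c
    rw [hm c]
    simp

/-- `V` is a collection (multiset) of votes over `C`. -/
def IsProfile (C : Finset Candidate) (V : Multiset (List Candidate)) : Prop :=
  ∀ v ∈ V, IsRanking C v

/-- An election `(C, V)`: a finite set `C` of candidates and a finite collection `V` of linear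
orders over `C`. -/
@[ext]
structure Election where
  cands : Finset Candidate
  votes : Multiset (List Candidate)
  isProfile : IsProfile cands votes

/-- The election with candidates `C ∩ D` (that is, `D` when `D ⊆ C`), every vote being masked down
to these candidates. -/
def Election.restrict (e : Election) (D : Finset Candidate) : Election where
  cands := e.cands ∩ D
  votes := e.votes.map (fun v => v.filter (fun c => c ∈ D))
  isProfile := by
    intro v hv
    obtain ⟨w, hw, rfl⟩ := Multiset.mem_map.1 hv
    obtain ⟨h1, h2⟩ := e.isProfile w hw
    exact ⟨h1.filter _, fun c => by simp [h2 c]⟩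

/-- An election system maps each election `(C, V)` to a subset of `C`, the set of winners
(which may be empty). -/
structure ElectionSystem where
  winners : Election → Finset Candidate
  winners_subset : ∀ e, winners e ⊆ e.cands

/-! ### Plurality and candidate-neutrality -/

/-- The number of votes that rank `c` first. -/
def Election.pluralityScore (e : Election) (c : Candidate) : ℕ :=
  e.votes.countP (fun v => v.head? = some c)

/-- Plurality: the winners are the candidates with the highest number of first places. -/
def plurality : ElectionSystem where
  winners e := {c ∈ e.cands | ∀ d ∈ e.cands, e.pluralityScore d ≤ e.pluralityScore c}
  winners_subset _ := Finset.filter_subset _ _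

/-- Rename all candidates by `σ`. -/
def Election.relabel (σ : Equiv.Perm Candidate) (e : Election) : Election where
  cands := e.cands.map σ.toEmbedding
  votes := e.votes.map (List.map σ)
  isProfile := by
    intro v hv
    obtain ⟨w, hw, rfl⟩ := Multiset.mem_map.1 hv
    obtain ⟨h1, h2⟩ := e.isProfile w hw
    exact ⟨h1.map σ.injective, fun c => by simp only [List.mem_map, Finset.mem_map, h2]; rfl⟩

/-- Candidate-neutrality: renaming the candidates renames the winners in the same way. -/
def ElectionSystem.Neutral (E : ElectionSystem) : Prop :=
  ∀ (σ : Equiv.Perm Candidate) (e : Election),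
    E.winners (e.relabel σ) = (E.winners e).map σ.toEmbedding

/-! ### The 44 control types -/

/-- Constructive (`CC`) or destructive (`DC`) control. -/
inductive Goal
  | CC
  | DC
  deriving DecidableEq

/-- Unique-winner (`UW`) or nonunique-winner (`NUW`) model. -/
inductive WinnerModel
  | UW
  | NUW
  deriving DecidableEq

/-- Ties eliminate (`TE`) or ties promote (`TP`). -/
inductive TieRule
  | TE
  | TP
  deriving DecidableEq

/-- The control actions: adding candidates (`AC`), unlimited adding of candidates (`UAC`), deleting
candidates (`DC`), adding voters (`AV`), deleting voters (`DV`), and, with a tie-handling rule for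
the first round, partition of voters (`PV`), partition of candidates (`PC`) and run-off partition
of candidates (`RPC`). -/
inductive ControlAction
  | AC
  | UAC
  | DC
  | AV
  | DV
  | PV (t : TieRule)
  | PC (t : TieRule)
  | RPC (t : TieRule)
  deriving DecidableEq

/-- A standard control type; for example `⟨.DC, .RPC .TE, .NUW⟩` is DC-RPC-TE-NUW. -/
structure ControlType where
  goal : Goal
  action : ControlAction
  model : WinnerModel
  deriving DecidableEq

/-! ### Inputs -/

/-- The fields of an input to control by (unlimited) adding of candidates, other than the focus
candidate and the limit: disjoint sets of registered and of spoiler candidates, and a collection of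
votes over their union. -/
structure SpoilerElection where
  registered : Finset Candidate
  spoilers : Finset Candidate
  disjoint : Disjoint registered spoilers
  votes : Multiset (List Candidate)
  isProfile : IsProfile (registered ∪ spoilers) votes

/-- The election with all registered and all spoiler candidates. -/
def SpoilerElection.full (s : SpoilerElection) : Election :=
  ⟨s.registered ∪ s.spoilers, s.votes, s.isProfile⟩

/-- The five kinds of input. -/
inductive InputKind
  | election
  | electionLimit
  | spoilerCandidates
  | spoilerCandidatesLimit
  | spoilerVotesLimit
  deriving DecidableEq

/-- The kind of input that a control action takes. -/
def ControlAction.inputKind : ControlAction → InputKind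
  | .AC => .spoilerCandidatesLimit
  | .UAC => .spoilerCandidates
  | .DC => .electionLimit
  | .AV => .spoilerVotesLimit
  | .DV => .electionLimit
  | .PV _ => .election
  | .PC _ => .election
  | .RPC _ => .election

/-- Two control types are compatible if their inputs have the same fields. -/
def Compatible (T T' : ControlType) : Prop :=
  T.action.inputKind = T'.action.inputKind

/-- Reduced inputs, i.e. inputs without the focus candidate, of each of the five kinds. -/
inductive ReducedInput
  /-- `(C, V)` -/
  | election (e : Election)
  /-- `(C, V, k)` -/
  | electionLimit (e : Election) (k : ℕ)
  /-- `(C, A, V)` -/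
  | spoilerCandidates (s : SpoilerElection)
  /-- `(C, A, V, k)` -/
  | spoilerCandidatesLimit (s : SpoilerElection) (k : ℕ)
  /-- `(C, V, W, k)` -/
  | spoilerVotesLimit (e : Election) (W : Multiset (List Candidate)) (hW : IsProfile e.cands W)
      (k : ℕ)

/-- The candidate set `C` of an input; the focus candidate has to belong to it. -/
def ReducedInput.cands : ReducedInput → Finset Candidate
  | .election e => e.cands
  | .electionLimit e _ => e.cands
  | .spoilerCandidates s => s.registered
  | .spoilerCandidatesLimit s _ => s.registered
  | .spoilerVotesLimit e _ _ _ => e.cands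

/-! ### The control problems -/

/-- `(C, V - V')` -/
def Election.deleteVotes (e : Election) (V' : Multiset (List Candidate)) : Election :=
  ⟨e.cands, e.votes - V', fun v hv => e.isProfile v (Multiset.mem_of_le tsub_le_self hv)⟩

/-- `(C, V ∪ W')`, where `W'` is a subcollection of the collection `W` of votes over `C`. -/
def Election.addVotes (e : Election) {W : Multiset (List Candidate)} (hW : IsProfile e.cands W)
    (W' : Multiset (List Candidate)) (h : W' ≤ W) : Election :=
  ⟨e.cands, e.votes + W', fun v hv => (Multiset.mem_add.1 hv).elim (e.isProfile v)
    (fun hv' => hW v (Multiset.mem_of_le h hv'))⟩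

/-- The candidates that proceed from the subelection `e` to the final round: all its winners under
ties promote, and only a unique winner under ties eliminate. -/
def ElectionSystem.survivors (E : ElectionSystem) (t : TieRule) (e : Election) :
    Finset Candidate :=
  match t with
  | .TP => E.winners e
  | .TE => if (E.winners e).card = 1 then E.winners e else ∅

/-- `Achievable E a I p S`: on the reduced input `I` with focus candidate `p`, some legal exercise
of the control action `a` leads to an election whose winner set under `E` is `S`. (It is false when
`I` is not of the kind that `a` takes.) -/
def Achievable (E : ElectionSystem) :
    ControlAction → ReducedInput → Candidate → Finset Candidate → Prop
  | .AC, .spoilerCandidatesLimit s k, _, S =>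
      ∃ A' ⊆ s.spoilers, A'.card ≤ k ∧ S = E.winners (s.full.restrict (s.registered ∪ A'))
  | .UAC, .spoilerCandidates s, _, S =>
      ∃ A' ⊆ s.spoilers, S = E.winners (s.full.restrict (s.registered ∪ A'))
  | .DC, .electionLimit e k, p, S =>
      ∃ C' ⊆ e.cands, C'.card ≤ k ∧ p ∉ C' ∧ S = E.winners (e.restrict (e.cands \ C'))
  | .AV, .spoilerVotesLimit e W hW k, _, S =>
      ∃ (W' : Multiset (List Candidate)) (h : W' ≤ W), W'.card ≤ k ∧
        S = E.winners (e.addVotes hW W' h)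
  | .DV, .electionLimit e k, _, S =>
      ∃ V' ≤ e.votes, V'.card ≤ k ∧ S = E.winners (e.deleteVotes V')
  | .PV t, .election e, _, S =>
      ∃ e₁ e₂ : Election, e₁.cands = e.cands ∧ e₂.cands = e.cands ∧
        e₁.votes + e₂.votes = e.votes ∧
        S = E.winners (e.restrict (E.survivors t e₁ ∪ E.survivors t e₂))
  | .PC t, .election e, _, S =>
      ∃ C₁ C₂ : Finset Candidate, C₁ ∪ C₂ = e.cands ∧ Disjoint C₁ C₂ ∧
        S = E.winners (e.restrict (E.survivors t (e.restrict C₁) ∪ C₂))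
  | .RPC t, .election e, _, S =>
      ∃ C₁ C₂ : Finset Candidate, C₁ ∪ C₂ = e.cands ∧ Disjoint C₁ C₂ ∧
        S = E.winners (e.restrict
          (E.survivors t (e.restrict C₁) ∪ E.survivors t (e.restrict C₂)))
  | _, _, _, _ => False

/-- The focus candidate `p` is a winner, in the given winner model, when `S` is the winner set. -/
def WinnerModel.Wins : WinnerModel → Candidate → Finset Candidate → Prop
  | .UW, p, S => S = {p}
  | .NUW, p, S => p ∈ S

/-- The goal is to make the focus candidate win, or to make it not win. -/
def Goal.Met : Goal → WinnerModel → Candidate → Finset Candidate → Prop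
  | .CC, m, p, S => m.Wins p S
  | .DC, m, p, S => ¬ m.Wins p S

/-- The set of yes-instances of control type `T` for the election system `E`: inputs consist
of a reduced input and a focus candidate. -/
def yesInstances (E : ElectionSystem) (T : ControlType) : Set (ReducedInput × Candidate) :=
  {x | x.2 ∈ x.1.cands ∧ ∃ S, Achievable E T.action x.1 x.2 S ∧ T.goal.Met T.model x.2 S}

/-- The function that maps a reduced input to the set of all candidates for which, as focus
candidate, control of type `T` is possible. -/
def controlFun (E : ElectionSystem) (T : ControlType) (I : ReducedInput) : Set Candidate :=
  {c | (I, c) ∈ yesInstances E T}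

/-! ### Collapse, separation, containment, incomparability for one election system -/

def CollapseFor (E : ElectionSystem) (T T' : ControlType) : Prop :=
  yesInstances E T = yesInstances E T'

def SeparateFor (E : ElectionSystem) (T T' : ControlType) : Prop :=
  yesInstances E T ≠ yesInstances E T'

def ContainedFor (E : ElectionSystem) (T T' : ControlType) : Prop :=
  ∀ I, controlFun E T I ⊆ controlFun E T' I

def StrictlyContainedFor (E : ElectionSystem) (T T' : ControlType) : Prop :=
  ContainedFor E T T' ∧ ∃ I, (controlFun E T' I \ controlFun E T I).Nonempty

def IncomparableFor (E : ElectionSystem) (T T' : ControlType) : Prop :=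
  SeparateFor E T T' ∧ ¬ StrictlyContainedFor E T T' ∧ ¬ StrictlyContainedFor E T' T

/-! ### The same notions in the general case -/

def GeneralCollapse (T T' : ControlType) : Prop :=
  ∀ E : ElectionSystem, CollapseFor E T T'

def GeneralSeparate (T T' : ControlType) : Prop :=
  ¬ GeneralCollapse T T'

def GeneralContained (T T' : ControlType) : Prop :=
  ∀ E : ElectionSystem, ContainedFor E T T'

/-- Containment holds for every election system, and is not an equality for at least one. -/
def GeneralStrictlyContained (T T' : ControlType) : Prop :=
  GeneralContained T T' ∧
    ∃ (E : ElectionSystem) (I : ReducedInput),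
      (controlFun E T' I \ controlFun E T I).Nonempty

def GeneralIncomparable (T T' : ControlType) : Prop :=
  ∃ E : ElectionSystem, IncomparableFor E T T'

/-! ### Pairs of control types -/

/-- The unordered pairs of distinct compatible control types that stand, in one of the two orders,
in the relation `R`. -/
def compatiblePairs (R : ControlType → ControlType → Prop) : Set (Sym2 ControlType) :=
  {z | ∃ T T' : ControlType, z = s(T, T') ∧ T ≠ T' ∧ Compatible T T' ∧ R T T'}

/-- The seven collapsing pairs. -/
def sevenCollapses : Set (Sym2 ControlType) :=
  { s(⟨.DC, .RPC .TE, .NUW⟩, ⟨.DC, .RPC .TE, .UW⟩),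
    s(⟨.DC, .RPC .TE, .NUW⟩, ⟨.DC, .PC .TE, .NUW⟩),
    s(⟨.DC, .RPC .TE, .NUW⟩, ⟨.DC, .PC .TE, .UW⟩),
    s(⟨.DC, .RPC .TE, .UW⟩, ⟨.DC, .PC .TE, .NUW⟩),
    s(⟨.DC, .RPC .TE, .UW⟩, ⟨.DC, .PC .TE, .UW⟩),
    s(⟨.DC, .PC .TE, .NUW⟩, ⟨.DC, .PC .TE, .UW⟩),
    s(⟨.DC, .RPC .TP, .NUW⟩, ⟨.DC, .PC .TP, .NUW⟩) }

/-- The list of the strict containments: the ones between the two winner models of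
a control action (first two items), and the ones among destructive candidate partition types. -/
def ListedStrict (T T' : ControlType) : Prop :=
  (∃ a : ControlAction, T = ⟨.CC, a, .UW⟩ ∧ T' = ⟨.CC, a, .NUW⟩) ∨
  (∃ a : ControlAction, a ≠ .RPC .TE ∧ a ≠ .PC .TE ∧ T = ⟨.DC, a, .NUW⟩ ∧ T' = ⟨.DC, a, .UW⟩) ∨
  ((T = ⟨.DC, .RPC .TP, .NUW⟩ ∨ T = ⟨.DC, .PC .TP, .NUW⟩) ∧
    (T' = ⟨.DC, .RPC .TP, .UW⟩ ∨ T' = ⟨.DC, .PC .TP, .UW⟩)) ∨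
  (∃ m m' : WinnerModel, (T = ⟨.DC, .RPC .TP, m⟩ ∨ T = ⟨.DC, .PC .TP, m⟩) ∧
    (T' = ⟨.DC, .RPC .TE, m'⟩ ∨ T' = ⟨.DC, .PC .TE, m'⟩))

/-!
The pairs in `sevenCollapses` and the containments in `ListedStrict` hold for every election system,
and everything else is refuted by plurality on small inputs.

*Positive part.* Containments between the unique- and the nonunique-winner model of one action are
immediate. The others concern destructive control by partition of candidates. There `p` is kept from
winning either because it does not survive the subelection on its own part `D`, or because it is
defeated in a final round on some `F` containing `p`. Conversely, a set `D` on which `p` does not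
survive can be made a part of the partition, and then `p` misses the final round. With ties
eliminating, "`p` does not survive `D`" and "`p` is not the unique winner on `D`" are the same, so
all four DC-(R)PC-TE types amount to the existence of a set `D` of candidates containing `p` on which
`p` is not the unique winner (`mem_yesInstances_TE`). With ties promoting, both DC-(R)PC-TP-NUW types
amount to the existence of a `D` containing `p` on which `p` is not a winner
(`mem_yesInstances_TP_NUW`). In DC-(R)PC-TP-UW, too, `p` fails to be the unique winner on its own part
or in the final round, which gives the containment in the TE types (`yesInstances_TP_subset_TE`).

*Negative part.* For every ordered pair `(T, T')` of distinct compatible types that is neither one of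
the collapses nor one of the listed containments, there is an input and a focus candidate for which
control of type `T` succeeds under plurality and control of type `T'` does not. A finite list of
inputs (`separatingInputs`) serves all these pairs. To check them, `ListInput.outcomes` lists the
winner sets that a control action can lead to, `achievable_iff` proves this list to be correct, and
`exists_separatingInput` evaluates it.

Both parts determine the relation of every compatible pair, in general and for plurality alike; the
numbers of pairs are then counted, as numbers of edges of graphs on the 44 types.
-/

/-! ### Destructive control by partition of candidates -/

theorem exists_partition {C D : Finset Candidate} (h : D ⊆ C) :
    D ∪ C \ D = C ∧ Disjoint D (C \ D) :=
  ⟨Finset.union_sdiff_of_subset h, Finset.disjoint_sdiff⟩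

theorem Election.restrict_cands_subset (e : Election) (D : Finset Candidate) :
    (e.restrict D).cands ⊆ D :=
  Finset.inter_subset_right

theorem ElectionSystem.winners_restrict_subset (E : ElectionSystem) (e : Election)
    (D : Finset Candidate) : E.winners (e.restrict D) ⊆ D :=
  (E.winners_subset _).trans (e.restrict_cands_subset D)

theorem ElectionSystem.mem_survivors_TE (E : ElectionSystem) (e : Election) (p : Candidate) :
    p ∈ E.survivors .TE e ↔ E.winners e = {p} := by
  unfold ElectionSystem.survivors
  split_ifs with h
  · obtain ⟨a, ha⟩ := Finset.card_eq_one.1 h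
    simp [ha, eq_comm]
  · constructor
    · simp
    · intro h'; simp [h'] at h

theorem ElectionSystem.survivors_restrict_subset (E : ElectionSystem) (t : TieRule) (e : Election)
    (D : Finset Candidate) : E.survivors t (e.restrict D) ⊆ D := by
  refine Finset.Subset.trans ?_ (E.winners_restrict_subset e D)
  cases t
  · unfold ElectionSystem.survivors
    split_ifs <;> simp
  · exact Finset.Subset.refl _

/-- The action is a partition of candidates, with or without run-off. -/
def ControlAction.IsCandPartition (a : ControlAction) (t : TieRule) : Prop :=
  a = .PC t ∨ a = .RPC t

theorem Election.restrict_self (e : Election) : e.restrict e.cands = e := by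
  ext1
  · exact Finset.inter_self _
  · refine (Multiset.map_congr rfl fun v hv => ?_).trans (Multiset.map_id _)
    simpa using fun c hc => ((e.isProfile v hv).2 c).1 hc

/-- If `p` does not survive the subelection on some `D` containing `p`, then making `D` a part of
the partition keeps `p` out of the final round, whatever happens to the other part. -/
theorem exists_achievable_not_mem {E : ElectionSystem} {a : ControlAction} {t : TieRule}
    (ha : a.IsCandPartition t) {e : Election} {D : Finset Candidate} (hD : D ⊆ e.cands)
    {p : Candidate} (hp : p ∈ D) (hs : p ∉ E.survivors t (e.restrict D)) :
    ∃ S, Achievable E a (.election e) p S ∧ p ∉ S := by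
  obtain ⟨h₁, h₂⟩ := exists_partition hD
  have hn : p ∉ e.cands \ D := fun h => (Finset.mem_sdiff.1 h).2 hp
  rcases ha with rfl | rfl
  · refine ⟨_, ⟨D, e.cands \ D, h₁, h₂, rfl⟩, fun h => ?_⟩
    rcases Finset.mem_union.1 (E.winners_restrict_subset _ _ h) with h | h
    exacts [hs h, hn h]
  · refine ⟨_, ⟨D, e.cands \ D, h₁, h₂, rfl⟩, fun h => ?_⟩
    rcases Finset.mem_union.1 (E.winners_restrict_subset _ _ h) with h | h
    exacts [hs h, hn (E.survivors_restrict_subset _ _ _ h)]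

/-- Conversely, the outcome of a partition of candidates is the winner set of a final round on some
`F`, and `p` takes part in it unless `p` was eliminated in the subelection on some `D`. -/
theorem exists_of_achievable {E : ElectionSystem} {a : ControlAction} {t : TieRule}
    (ha : a.IsCandPartition t) {e : Election} {p : Candidate} (hp : p ∈ e.cands)
    {S : Finset Candidate} (h : Achievable E a (.election e) p S) :
    (∃ F ⊆ e.cands, p ∈ F ∧ S = E.winners (e.restrict F)) ∨
      ∃ D ⊆ e.cands, p ∈ D ∧ p ∉ E.survivors t (e.restrict D) := by
  rw [or_iff_not_imp_right]
  intro hD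
  push Not at hD
  -- If `p` survives every subelection that it takes part in, it survives its own part.
  have key : ∀ C₁ C₂ : Finset Candidate, C₁ ∪ C₂ = e.cands →
      (p ∈ C₁ ∧ p ∈ E.survivors t (e.restrict C₁)) ∨
        (p ∈ C₂ ∧ p ∈ E.survivors t (e.restrict C₂)) := by
    intro C₁ C₂ h₁
    rw [← h₁] at hp hD
    rcases Finset.mem_union.1 hp with h | h
    · exact .inl ⟨h, hD _ Finset.subset_union_left h⟩
    · exact .inr ⟨h, hD _ Finset.subset_union_right h⟩
  rcases ha with rfl | rfl
  · obtain ⟨C₁, C₂, h₁, -, rfl⟩ := h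
    refine ⟨_, ?_, ?_, rfl⟩
    · rw [← h₁]
      exact Finset.union_subset_union (E.survivors_restrict_subset _ _ _) Finset.Subset.rfl
    · rcases key _ _ h₁ with h | h
      exacts [Finset.mem_union_left _ h.2, Finset.mem_union_right _ h.1]
  · obtain ⟨C₁, C₂, h₁, -, rfl⟩ := h
    refine ⟨_, ?_, ?_, rfl⟩
    · rw [← h₁]
      exact Finset.union_subset_union (E.survivors_restrict_subset _ _ _)
        (E.survivors_restrict_subset _ _ _)
    · rcases key _ _ h₁ with h | h
      exacts [Finset.mem_union_left _ h.2, Finset.mem_union_right _ h.2]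

/-- Only inputs of the kind `(C, V)` admit a partition of candidates. -/
theorem ControlAction.IsCandPartition.exists_eq_election {a : ControlAction} {t : TieRule}
    (ha : a.IsCandPartition t) {E : ElectionSystem} {I : ReducedInput} {p : Candidate}
    {S : Finset Candidate} (h : Achievable E a I p S) : ∃ e, I = .election e := by
  rcases ha with rfl | rfl <;> cases I <;> first | exact ⟨_, rfl⟩ | exact h.elim

/-- Destructive control by partition of candidates with ties eliminating: the focus candidate has
to be other than the unique winner among some set `D` of candidates to which it belongs. Neither
the kind of the partition nor the winner model matters. -/
theorem mem_yesInstances_TE {E : ElectionSystem} {a : ControlAction} (ha : a.IsCandPartition .TE)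
    (m : WinnerModel) (I : ReducedInput) (p : Candidate) :
    (I, p) ∈ yesInstances E ⟨.DC, a, m⟩ ↔
      ∃ e, I = .election e ∧ ∃ D ⊆ e.cands, p ∈ D ∧ E.winners (e.restrict D) ≠ {p} := by
  constructor
  · rintro ⟨hp, S, hS, hm⟩
    obtain ⟨e, rfl⟩ := ha.exists_eq_election hS
    have hne : S ≠ {p} := by
      rintro rfl
      cases m
      exacts [hm rfl, hm (Finset.mem_singleton_self p)]
    refine ⟨e, rfl, ?_⟩
    rcases exists_of_achievable ha hp hS with ⟨F, hF, hpF, rfl⟩ | ⟨D, hD, hpD, hs⟩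
    · exact ⟨F, hF, hpF, hne⟩
    · exact ⟨D, hD, hpD, fun h => hs ((E.mem_survivors_TE _ _).2 h)⟩
  · rintro ⟨e, rfl, D, hD, hpD, hne⟩
    obtain ⟨S, hS, hpS⟩ := exists_achievable_not_mem ha hD hpD
      (fun h => hne ((E.mem_survivors_TE _ _).1 h))
    refine ⟨hD hpD, S, hS, ?_⟩
    cases m
    · intro h
      exact hpS (h ▸ Finset.mem_singleton_self p)
    · exact hpS

/-- Destructive control by partition of candidates with ties promoting, in the nonunique-winner
model: the focus candidate has to lose among some set `D` of candidates to which it belongs. -/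
theorem mem_yesInstances_TP_NUW {E : ElectionSystem} {a : ControlAction}
    (ha : a.IsCandPartition .TP) (I : ReducedInput) (p : Candidate) :
    (I, p) ∈ yesInstances E ⟨.DC, a, .NUW⟩ ↔
      ∃ e, I = .election e ∧ ∃ D ⊆ e.cands, p ∈ D ∧ p ∉ E.winners (e.restrict D) := by
  constructor
  · rintro ⟨hp, S, hS, hm⟩
    obtain ⟨e, rfl⟩ := ha.exists_eq_election hS
    refine ⟨e, rfl, ?_⟩
    rcases exists_of_achievable ha hp hS with ⟨F, hF, hpF, rfl⟩ | h
    exacts [⟨F, hF, hpF, hm⟩, h]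
  · rintro ⟨e, rfl, D, hD, hpD, hn⟩
    obtain ⟨S, hS, hpS⟩ := exists_achievable_not_mem ha hD hpD (t := .TP) hn
    exact ⟨hD hpD, S, hS, hpS⟩

/-! ### Containments and collapses for every election system -/

theorem yesInstances_CC_UW_subset (E : ElectionSystem) (a : ControlAction) :
    yesInstances E ⟨.CC, a, .UW⟩ ⊆ yesInstances E ⟨.CC, a, .NUW⟩ := by
  rintro ⟨I, p⟩ ⟨hp, S, hS, hm⟩
  obtain rfl : S = {p} := hm
  exact ⟨hp, _, hS, Finset.mem_singleton_self p⟩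

theorem yesInstances_DC_NUW_subset (E : ElectionSystem) (a : ControlAction) :
    yesInstances E ⟨.DC, a, .NUW⟩ ⊆ yesInstances E ⟨.DC, a, .UW⟩ := by
  rintro ⟨I, p⟩ ⟨hp, S, hS, hm⟩
  refine ⟨hp, S, hS, fun h => hm ?_⟩
  obtain rfl : S = {p} := h
  exact Finset.mem_singleton_self p

/-- Under ties promoting, a candidate that is prevented from being the unique winner is not the
unique winner in the final round, or it lost its subelection; either way there is a set of
candidates on which it is not the unique winner. -/
theorem yesInstances_TP_subset_TE (E : ElectionSystem) {a b : ControlAction}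
    (ha : a.IsCandPartition .TP) (hb : b.IsCandPartition .TE) (m m' : WinnerModel) :
    yesInstances E ⟨.DC, a, m⟩ ⊆ yesInstances E ⟨.DC, b, m'⟩ := by
  have key : yesInstances E ⟨.DC, a, .UW⟩ ⊆ yesInstances E ⟨.DC, b, m'⟩ := by
    rintro ⟨I, p⟩ ⟨hp, S, hS, hm⟩
    obtain ⟨e, rfl⟩ := ha.exists_eq_election hS
    refine (mem_yesInstances_TE hb m' _ _).2 ⟨e, rfl, ?_⟩
    rcases exists_of_achievable ha hp hS with ⟨F, hF, hpF, rfl⟩ | ⟨D, hD, hpD, hs⟩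
    · exact ⟨F, hF, hpF, hm⟩
    · refine ⟨D, hD, hpD, fun h => hs ?_⟩
      change p ∈ E.winners _
      exact h ▸ Finset.mem_singleton_self p
  cases m
  exacts [key, (yesInstances_DC_NUW_subset E a).trans key]

theorem yesInstances_TE_eq (E : ElectionSystem) {a b : ControlAction}
    (ha : a.IsCandPartition .TE) (hb : b.IsCandPartition .TE) (m m' : WinnerModel) :
    yesInstances E ⟨.DC, a, m⟩ = yesInstances E ⟨.DC, b, m'⟩ := by
  ext ⟨I, p⟩
  rw [mem_yesInstances_TE ha, mem_yesInstances_TE hb]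

theorem yesInstances_TP_NUW_eq (E : ElectionSystem) {a b : ControlAction}
    (ha : a.IsCandPartition .TP) (hb : b.IsCandPartition .TP) :
    yesInstances E ⟨.DC, a, .NUW⟩ = yesInstances E ⟨.DC, b, .NUW⟩ := by
  ext ⟨I, p⟩
  rw [mem_yesInstances_TP_NUW ha, mem_yesInstances_TP_NUW hb]

theorem containedFor_iff {E : ElectionSystem} {T T' : ControlType} :
    ContainedFor E T T' ↔ yesInstances E T ⊆ yesInstances E T' :=
  ⟨fun h x hx => h x.1 hx, fun h _ _ hc => h hc⟩

theorem ListedStrict.containedFor {T T' : ControlType} (h : ListedStrict T T')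
    (E : ElectionSystem) : ContainedFor E T T' := by
  rw [containedFor_iff]
  rcases h with ⟨a, rfl, rfl⟩ | ⟨a, -, -, rfl, rfl⟩ | ⟨hT, hT'⟩ | ⟨m, m', hT, hT'⟩
  · exact yesInstances_CC_UW_subset E a
  · exact yesInstances_DC_NUW_subset E a
  · rcases hT with rfl | rfl <;> rcases hT' with rfl | rfl
    · exact yesInstances_DC_NUW_subset E _
    · exact (yesInstances_TP_NUW_eq E (.inr rfl) (.inl rfl)).subset.trans
        (yesInstances_DC_NUW_subset E _)
    · exact (yesInstances_TP_NUW_eq E (.inl rfl) (.inr rfl)).subset.trans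
        (yesInstances_DC_NUW_subset E _)
    · exact yesInstances_DC_NUW_subset E _
  · have : ∃ a b : ControlAction, a.IsCandPartition .TP ∧ b.IsCandPartition .TE ∧
        T = ⟨.DC, a, m⟩ ∧ T' = ⟨.DC, b, m'⟩ := by
      rcases hT with rfl | rfl <;> rcases hT' with rfl | rfl
      exacts [⟨_, _, .inr rfl, .inr rfl, rfl, rfl⟩, ⟨_, _, .inr rfl, .inl rfl, rfl, rfl⟩,
        ⟨_, _, .inl rfl, .inr rfl, rfl, rfl⟩, ⟨_, _, .inl rfl, .inl rfl, rfl, rfl⟩]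
    obtain ⟨a, b, ha, hb, rfl, rfl⟩ := this
    exact yesInstances_TP_subset_TE E ha hb m m'

theorem collapseFor_of_mem_sevenCollapses {T T' : ControlType} (h : s(T, T') ∈ sevenCollapses)
    (E : ElectionSystem) : CollapseFor E T T' := by
  simp only [sevenCollapses, Set.mem_insert_iff, Set.mem_singleton_iff, Sym2.eq_iff] at h
  unfold CollapseFor
  rcases h with h | h | h | h | h | h | h <;> rcases h with ⟨rfl, rfl⟩ | ⟨rfl, rfl⟩ <;>
    first
    | (apply yesInstances_TE_eq E <;> simp [ControlAction.IsCandPartition]; done)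
    | (apply yesInstances_TP_NUW_eq E <;> simp [ControlAction.IsCandPartition])

/-! ### Plurality on weighted lists of votes -/

/-- A collection of votes as a list of rankings with multiplicities. -/
abbrev WeightedVotes := List (List Candidate × ℕ)

/-- The multiset of votes that a list with multiplicities stands for. -/
def WeightedVotes.expand (V : WeightedVotes) : Multiset (List Candidate) :=
  (V.map fun x => Multiset.replicate x.2 x.1).sum

/-- The number of votes. -/
def WeightedVotes.size (V : WeightedVotes) : ℕ :=
  (V.map Prod.snd).sum

/-- The number of first places of `c` when the votes are masked down to `D`. -/
def WeightedVotes.score (V : WeightedVotes) (D : List Candidate) (c : Candidate) : ℕ :=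
  (V.map fun x => if x.1.find? (· ∈ D) = some c then x.2 else 0).sum

/-- The plurality winners among the candidates in `D`. -/
def WeightedVotes.winners (V : WeightedVotes) (D : List Candidate) : List Candidate :=
  D.filter fun c => D.all fun d => V.score D d ≤ V.score D c

/-- All ways to split a collection of votes into two parts. -/
def WeightedVotes.splits : WeightedVotes → List (WeightedVotes × WeightedVotes)
  | [] => [([], [])]
  | (v, n) :: V => (List.range (n + 1)).flatMap fun k =>
      (splits V).map fun x => ((v, k) :: x.1, (v, n - k) :: x.2)

@[simp] theorem WeightedVotes.expand_nil : expand [] = 0 := rfl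

@[simp] theorem WeightedVotes.expand_cons (x : List Candidate × ℕ) (V : WeightedVotes) :
    expand (x :: V) = Multiset.replicate x.2 x.1 + expand V := by
  simp [expand]

@[simp] theorem WeightedVotes.expand_append (V W : WeightedVotes) :
    expand (V ++ W) = expand V + expand W := by
  simp [expand]

@[simp] theorem WeightedVotes.card_expand (V : WeightedVotes) :
    Multiset.card V.expand = V.size := by
  induction V with
  | nil => rfl
  | cons x V ih => simpa [size] using ih

theorem WeightedVotes.exists_mem_of_mem_expand {V : WeightedVotes} {v : List Candidate}
    (h : v ∈ V.expand) : ∃ x ∈ V, x.1 = v := by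
  induction V with
  | nil => simp at h
  | cons x V ih =>
    rw [expand_cons, Multiset.mem_add] at h
    rcases h with h | h
    · exact ⟨x, by simp, (Multiset.eq_of_mem_replicate h).symm⟩
    · obtain ⟨y, hy, rfl⟩ := ih h
      exact ⟨y, by simp [hy], rfl⟩

theorem WeightedVotes.countP_expand (V : WeightedVotes) (q : List Candidate → Prop)
    [DecidablePred q] :
    V.expand.countP q = (V.map fun x => if q x.1 then x.2 else 0).sum := by
  induction V with
  | nil => rfl
  | cons x V ih =>
    rw [expand_cons, Multiset.countP_add, ih, List.map_cons, List.sum_cons]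
    congr 1
    rw [← Multiset.coe_replicate, Multiset.coe_countP, List.countP_replicate]
    simp

/-- Two multisets that add up to `A + B` arise by splitting `A` and `B`. -/
theorem Multiset.exists_add_of_add_eq_add {α : Type*} [DecidableEq α] {s t A B : Multiset α}
    (h : s + t = A + B) : ∃ s₁ s₂ t₁ t₂, s = s₁ + s₂ ∧ t = t₁ + t₂ ∧ s₁ + t₁ = A ∧
      s₂ + t₂ = B := by
  refine ⟨s ∩ A, s - A, A - s, t - (A - s), ?_, ?_, ?_, ?_⟩ <;> ext a <;>
    have := congrArg (Multiset.count a) h <;>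
    simp only [Multiset.count_add, Multiset.count_inter, Multiset.count_sub] at this ⊢ <;> omega

theorem WeightedVotes.add_eq_expand_iff {V : WeightedVotes} {s t : Multiset (List Candidate)} :
    s + t = V.expand ↔ ∃ x ∈ V.splits, s = x.1.expand ∧ t = x.2.expand := by
  induction V generalizing s t with
  | nil => simp [splits]
  | cons y V ih =>
    obtain ⟨v, n⟩ := y
    simp only [splits, List.mem_flatMap, List.mem_range, List.mem_map, expand_cons]
    constructor
    · intro h
      obtain ⟨s₁, s₂, t₁, t₂, rfl, rfl, h₁, h₂⟩ := Multiset.exists_add_of_add_eq_add h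
      obtain ⟨x, hx, rfl, rfl⟩ := ih.1 h₂
      have hs : s₁ = Multiset.replicate (Multiset.card s₁) v := Multiset.eq_replicate_card.2
        fun b hb => Multiset.eq_of_mem_replicate (h₁ ▸ Multiset.mem_add.2 (.inl hb))
      have ht : t₁ = Multiset.replicate (Multiset.card t₁) v := Multiset.eq_replicate_card.2
        fun b hb => Multiset.eq_of_mem_replicate (h₁ ▸ Multiset.mem_add.2 (.inr hb))
      have hc := congrArg Multiset.card h₁
      rw [Multiset.card_add, Multiset.card_replicate] at hc
      refine ⟨_, ⟨Multiset.card s₁, by omega, x, hx, rfl⟩, ?_, ?_⟩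
      · rw [expand_cons, ← hs]
      · rw [expand_cons, show n - Multiset.card s₁ = Multiset.card t₁ by omega, ← ht]
    · rintro ⟨_, ⟨k, hk, x, hx, rfl⟩, rfl, rfl⟩
      have hV := ih.2 ⟨x, hx, rfl, rfl⟩
      rw [← hV, expand_cons, expand_cons]
      conv_rhs => rw [show n = k + (n - k) by omega, Multiset.replicate_add]
      exact add_add_add_comm _ _ _ _

/-- A subcollection of votes is the first part of a split. -/
theorem WeightedVotes.le_expand_iff {V : WeightedVotes} {s : Multiset (List Candidate)} :
    s ≤ V.expand ↔ ∃ x ∈ V.splits, s = x.1.expand ∧ V.expand - s = x.2.expand := by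
  constructor
  · intro h
    exact add_eq_expand_iff.1 (add_tsub_cancel_of_le h)
  · rintro ⟨x, hx, rfl, h⟩
    rw [← add_eq_expand_iff.2 ⟨x, hx, rfl, rfl⟩]
    exact Multiset.le_add_right _ _

theorem WeightedVotes.winners_subset (V : WeightedVotes) (D : List Candidate) :
    V.winners D ⊆ D :=
  List.filter_subset_self _

theorem WeightedVotes.nodup_winners (V : WeightedVotes) {D : List Candidate} (h : D.Nodup) :
    (V.winners D).Nodup :=
  h.filter _

theorem plurality_winners_restrict {e : Election} {V : WeightedVotes} (hV : e.votes = V.expand)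
    {D : List Candidate} {F : Finset Candidate} (hF : F = D.toFinset) (hD : F ⊆ e.cands) :
    plurality.winners (e.restrict F) = (V.winners D).toFinset := by
  subst hF
  have hs (c : Candidate) : (e.restrict D.toFinset).pluralityScore c = V.score D c := by
    change (e.votes.map _).countP _ = _
    rw [hV, Multiset.countP_map, ← Multiset.countP_eq_card_filter, WeightedVotes.countP_expand]
    simp [WeightedVotes.score, List.head?_filter]
  have hm (c : Candidate) : c ∈ (e.restrict D.toFinset).cands ↔ c ∈ D := by
    change c ∈ e.cands ∩ D.toFinset ↔ c ∈ D
    rw [Finset.inter_eq_right.2 hD, List.mem_toFinset]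
  ext c
  simp [plurality, hs, hm, WeightedVotes.winners]

theorem plurality_winners {e : Election} {V : WeightedVotes} (hV : e.votes = V.expand)
    {C : List Candidate} (hC : e.cands = C.toFinset) :
    plurality.winners e = (V.winners C).toFinset := by
  conv_lhs => rw [← e.restrict_self]
  exact plurality_winners_restrict hV hC Finset.Subset.rfl

/-- The survivors of a subelection with winners `L`. -/
def TieRule.surviving : TieRule → List Candidate → List Candidate
  | .TP, L => L
  | .TE, L => if L.length = 1 then L else []

theorem TieRule.surviving_subset (t : TieRule) (L : List Candidate) : t.surviving L ⊆ L := by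
  cases t
  · unfold TieRule.surviving
    dsimp only
    split_ifs <;> simp
  · exact List.Subset.refl _

theorem ElectionSystem.survivors_eq {E : ElectionSystem} {e : Election} {L : List Candidate}
    (hL : L.Nodup) (h : E.winners e = L.toFinset) (t : TieRule) :
    E.survivors t e = (t.surviving L).toFinset := by
  cases t
  · simp only [survivors, TieRule.surviving, h, List.toFinset_card_of_nodup hL]
    split_ifs <;> rfl
  · exact h

/-- The subsets of the set that a list enumerates, each as a list. -/
theorem subset_toFinset_iff {C : List Candidate} {F : Finset Candidate} :
    F ⊆ C.toFinset ↔ ∃ L ∈ C.sublists, F = L.toFinset := by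
  constructor
  · intro h
    refine ⟨C.filter (· ∈ F), List.mem_sublists.2 List.filter_sublist, ?_⟩
    ext c
    simpa using fun hc => List.mem_toFinset.1 (h hc)
  · rintro ⟨L, hL, rfl⟩
    exact fun c hc => List.mem_toFinset.2
      ((List.mem_sublists.1 hL).subset (List.mem_toFinset.1 hc))

/-- The candidates in `C` that are not in `L`. -/
def complementIn (C L : List Candidate) : List Candidate :=
  C.filter fun c => c ∉ L

theorem toFinset_complementIn (C L : List Candidate) :
    (complementIn C L).toFinset = C.toFinset \ L.toFinset := by
  ext; simp [complementIn]

/-! ### Outcomes of control on concrete inputs -/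

/-- A concrete input to a control problem, all fields being lists; `extra` is the collection of
votes that may be added. A control action uses those of the fields that its kind of input has. -/
structure ListInput where
  cands : List Candidate
  spoilers : List Candidate
  votes : WeightedVotes
  extra : WeightedVotes
  limit : ℕ

/-- The candidates over whom the votes are cast. -/
def ListInput.voted (d : ListInput) : InputKind → List Candidate
  | .spoilerCandidates | .spoilerCandidatesLimit => d.cands ++ d.spoilers
  | _ => d.cands

/-- The fields are those of a legal input of the given kind. -/
structure ListInput.Valid (d : ListInput) (κ : InputKind) : Prop where
  nodup : (d.cands ++ d.spoilers).Nodup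
  votes_perm : ∀ x ∈ d.votes, x.1.Perm (d.voted κ)
  extra_perm : ∀ x ∈ d.extra, x.1.Perm d.cands

instance (d : ListInput) (κ : InputKind) : Decidable (d.Valid κ) :=
  decidable_of_iff ((d.cands ++ d.spoilers).Nodup ∧ (∀ x ∈ d.votes, x.1.Perm (d.voted κ)) ∧
    ∀ x ∈ d.extra, x.1.Perm d.cands) ⟨fun h => ⟨h.1, h.2.1, h.2.2⟩, fun h => ⟨h.1, h.2, h.3⟩⟩

/-- The list input stands for the reduced input, which is of the given kind. -/
def ListInput.Represents (d : ListInput) : InputKind → ReducedInput → Prop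
  | .election, .election e => e.cands = d.cands.toFinset ∧ e.votes = d.votes.expand
  | .electionLimit, .electionLimit e k =>
      e.cands = d.cands.toFinset ∧ e.votes = d.votes.expand ∧ k = d.limit
  | .spoilerCandidates, .spoilerCandidates s =>
      s.registered = d.cands.toFinset ∧ s.spoilers = d.spoilers.toFinset ∧
        s.votes = d.votes.expand
  | .spoilerCandidatesLimit, .spoilerCandidatesLimit s k =>
      s.registered = d.cands.toFinset ∧ s.spoilers = d.spoilers.toFinset ∧
        s.votes = d.votes.expand ∧ k = d.limit
  | .spoilerVotesLimit, .spoilerVotesLimit e W _ k =>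
      e.cands = d.cands.toFinset ∧ e.votes = d.votes.expand ∧ W = d.extra.expand ∧ k = d.limit
  | _, _ => False

theorem WeightedVotes.isProfile_expand {V : WeightedVotes} {D : List Candidate} (hD : D.Nodup)
    {F : Finset Candidate} (hF : F = D.toFinset) (h : ∀ x ∈ V, x.1.Perm D) :
    IsProfile F V.expand := by
  intro v hv
  obtain ⟨x, hx, rfl⟩ := exists_mem_of_mem_expand hv
  exact ⟨(h x hx).nodup_iff.2 hD, fun c => by rw [hF, List.mem_toFinset, (h x hx).mem_iff]⟩

theorem ListInput.Valid.exists_represents {d : ListInput} {κ : InputKind} (h : d.Valid κ) :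
    ∃ I, d.Represents κ I := by
  have hc : d.cands.Nodup := h.nodup.of_append_left
  have hW : IsProfile d.cands.toFinset d.extra.expand :=
    WeightedVotes.isProfile_expand hc rfl h.extra_perm
  have hs : Disjoint d.cands.toFinset d.spoilers.toFinset :=
    List.disjoint_toFinset_iff_disjoint.2 (List.disjoint_of_nodup_append h.nodup)
  have hv := h.votes_perm
  cases κ
  case election =>
    exact ⟨.election ⟨_, _, WeightedVotes.isProfile_expand hc rfl hv⟩, rfl, rfl⟩
  case electionLimit =>
    exact ⟨.electionLimit ⟨_, _, WeightedVotes.isProfile_expand hc rfl hv⟩ _, rfl, rfl, rfl⟩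
  case spoilerCandidates =>
    exact ⟨.spoilerCandidates ⟨_, _, hs, _, WeightedVotes.isProfile_expand h.nodup
      List.toFinset_append.symm hv⟩, rfl, rfl, rfl⟩
  case spoilerCandidatesLimit =>
    exact ⟨.spoilerCandidatesLimit ⟨_, _, hs, _, WeightedVotes.isProfile_expand h.nodup
      List.toFinset_append.symm hv⟩ _, rfl, rfl, rfl, rfl⟩
  case spoilerVotesLimit =>
    exact ⟨.spoilerVotesLimit ⟨_, _, WeightedVotes.isProfile_expand hc rfl hv⟩ _ hW _,
      rfl, rfl, rfl, rfl⟩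

/-- The plurality winner sets of the elections that the control action, exercised with focus
candidate `p`, can lead to. A final round may list a candidate twice, which changes no winner set;
the numbers of candidates added or deleted are compared with the limit after removing duplicates, so
that they are cardinalities of sets. -/
def ListInput.outcomes (d : ListInput) (p : Candidate) : ControlAction → List (List Candidate)
  | .AC => (d.spoilers.sublists.filter fun A => A.dedup.length ≤ d.limit).map
      fun A => d.votes.winners (d.cands ++ A)
  | .UAC => d.spoilers.sublists.map fun A => d.votes.winners (d.cands ++ A)
  | .DC => (d.cands.sublists.filter fun L => L.dedup.length ≤ d.limit ∧ p ∉ L).map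
      fun L => d.votes.winners (complementIn d.cands L)
  | .AV => (d.extra.splits.filter fun x => x.1.size ≤ d.limit).map
      fun x => WeightedVotes.winners (d.votes ++ x.1) d.cands
  | .DV => (d.votes.splits.filter fun x => x.1.size ≤ d.limit).map
      fun x => x.2.winners d.cands
  | .PV t => d.votes.splits.map fun x => d.votes.winners
      (t.surviving (x.1.winners d.cands) ++ t.surviving (x.2.winners d.cands))
  | .PC t => d.cands.sublists.map fun L => d.votes.winners
      (t.surviving (d.votes.winners L) ++ complementIn d.cands L)
  | .RPC t => d.cands.sublists.map fun L => d.votes.winners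
      (t.surviving (d.votes.winners L) ++
        t.surviving (d.votes.winners (complementIn d.cands L)))

theorem exists_partition_iff {C : List Candidate} {P : Finset Candidate → Finset Candidate → Prop} :
    (∃ C₁ C₂, C₁ ∪ C₂ = C.toFinset ∧ Disjoint C₁ C₂ ∧ P C₁ C₂) ↔
      ∃ L ∈ C.sublists, P L.toFinset (complementIn C L).toFinset := by
  constructor
  · rintro ⟨C₁, C₂, h, hd, hP⟩
    obtain ⟨L, hL, rfl⟩ := subset_toFinset_iff.1 (Finset.subset_union_left.trans h.subset)
    refine ⟨L, hL, ?_⟩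
    rwa [toFinset_complementIn, ← h, Finset.union_sdiff_cancel_left hd]
  · rintro ⟨L, hL, hP⟩
    obtain ⟨h₁, h₂⟩ := exists_partition (subset_toFinset_iff.2 ⟨L, hL, rfl⟩)
    rw [← toFinset_complementIn] at h₁ h₂
    exact ⟨_, _, h₁, h₂, hP⟩

section
variable {d : ListInput} {p : Candidate} {S : Finset Candidate} {e : Election}

theorem achievable_AC_iff {s : SpoilerElection} {k : ℕ}
    (h : d.Represents .spoilerCandidatesLimit (.spoilerCandidatesLimit s k)) :
    Achievable plurality .AC (.spoilerCandidatesLimit s k) p S ↔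
      ∃ L ∈ d.outcomes p .AC, S = L.toFinset := by
  obtain ⟨hc, ha, hv, rfl⟩ := h
  have key (A : List Candidate) (hA : A.toFinset ⊆ s.spoilers) :
      plurality.winners (s.full.restrict (s.registered ∪ A.toFinset)) =
        (d.votes.winners (d.cands ++ A)).toFinset :=
    plurality_winners_restrict hv (by rw [hc, List.toFinset_append])
      (Finset.union_subset_union Finset.Subset.rfl hA)
  simp only [Achievable, ListInput.outcomes, List.mem_map, List.mem_filter, decide_eq_true_eq]
  constructor
  · rintro ⟨A', hA', hk, rfl⟩
    obtain ⟨A, hA, rfl⟩ := subset_toFinset_iff.1 (hA'.trans ha.subset)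
    exact ⟨_, ⟨A, ⟨hA, by rwa [List.card_toFinset] at hk⟩, rfl⟩, key A hA'⟩
  · rintro ⟨_, ⟨A, ⟨hA, hk⟩, rfl⟩, rfl⟩
    have hs : A.toFinset ⊆ s.spoilers := ha ▸ subset_toFinset_iff.2 ⟨A, hA, rfl⟩
    exact ⟨_, hs, by rwa [List.card_toFinset], (key A hs).symm⟩

theorem achievable_UAC_iff {s : SpoilerElection}
    (h : d.Represents .spoilerCandidates (.spoilerCandidates s)) :
    Achievable plurality .UAC (.spoilerCandidates s) p S ↔
      ∃ L ∈ d.outcomes p .UAC, S = L.toFinset := by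
  obtain ⟨hc, ha, hv⟩ := h
  have key (A : List Candidate) (hA : A.toFinset ⊆ s.spoilers) :
      plurality.winners (s.full.restrict (s.registered ∪ A.toFinset)) =
        (d.votes.winners (d.cands ++ A)).toFinset :=
    plurality_winners_restrict hv (by rw [hc, List.toFinset_append])
      (Finset.union_subset_union Finset.Subset.rfl hA)
  simp only [Achievable, ListInput.outcomes, List.mem_map]
  constructor
  · rintro ⟨A', hA', rfl⟩
    obtain ⟨A, hA, rfl⟩ := subset_toFinset_iff.1 (hA'.trans ha.subset)
    exact ⟨_, ⟨A, hA, rfl⟩, key A hA'⟩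
  · rintro ⟨_, ⟨A, hA, rfl⟩, rfl⟩
    have hs : A.toFinset ⊆ s.spoilers := ha ▸ subset_toFinset_iff.2 ⟨A, hA, rfl⟩
    exact ⟨_, hs, (key A hs).symm⟩

theorem achievable_DC_iff {k : ℕ} (h : d.Represents .electionLimit (.electionLimit e k)) :
    Achievable plurality .DC (.electionLimit e k) p S ↔
      ∃ L ∈ d.outcomes p .DC, S = L.toFinset := by
  obtain ⟨hc, hv, rfl⟩ := h
  have key (L : List Candidate) : plurality.winners (e.restrict (e.cands \ L.toFinset)) =
      (d.votes.winners (complementIn d.cands L)).toFinset :=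
    plurality_winners_restrict hv (by rw [hc, toFinset_complementIn]) Finset.sdiff_subset
  simp only [Achievable, ListInput.outcomes, List.mem_map, List.mem_filter, decide_eq_true_eq]
  constructor
  · rintro ⟨C', hC', hk, hp, rfl⟩
    obtain ⟨L, hL, rfl⟩ := subset_toFinset_iff.1 (hC'.trans hc.subset)
    rw [List.card_toFinset] at hk
    rw [List.mem_toFinset] at hp
    exact ⟨_, ⟨L, ⟨hL, hk, hp⟩, rfl⟩, key L⟩
  · rintro ⟨_, ⟨L, ⟨hL, hk, hp⟩, rfl⟩, rfl⟩
    exact ⟨_, hc ▸ subset_toFinset_iff.2 ⟨L, hL, rfl⟩, by rwa [List.card_toFinset],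
      by rwa [List.mem_toFinset], (key L).symm⟩

theorem achievable_AV_iff {W : Multiset (List Candidate)} {hW : IsProfile e.cands W} {k : ℕ}
    (h : d.Represents .spoilerVotesLimit (.spoilerVotesLimit e W hW k)) :
    Achievable plurality .AV (.spoilerVotesLimit e W hW k) p S ↔
      ∃ L ∈ d.outcomes p .AV, S = L.toFinset := by
  obtain ⟨hc, hv, rfl, rfl⟩ := h
  simp only [Achievable, ListInput.outcomes, List.mem_map, List.mem_filter, decide_eq_true_eq]
  have key (W' : Multiset (List Candidate)) (h : W' ≤ d.extra.expand) (x : WeightedVotes)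
      (hx : W' = x.expand) : plurality.winners (e.addVotes hW W' h) =
        (WeightedVotes.winners (d.votes ++ x) d.cands).toFinset :=
    plurality_winners (by simp [Election.addVotes, hv, hx]) hc
  constructor
  · rintro ⟨W', h, hk, rfl⟩
    obtain ⟨x, hx, hW', -⟩ := WeightedVotes.le_expand_iff.1 h
    exact ⟨_, ⟨x, ⟨hx, by rwa [hW', WeightedVotes.card_expand] at hk⟩, rfl⟩, key W' h _ hW'⟩
  · rintro ⟨_, ⟨x, ⟨hx, hk⟩, rfl⟩, rfl⟩
    have h : x.1.expand ≤ d.extra.expand := by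
      rw [← WeightedVotes.add_eq_expand_iff.2 ⟨x, hx, rfl, rfl⟩]
      exact Multiset.le_add_right _ _
    exact ⟨_, h, by rwa [WeightedVotes.card_expand], (key _ h _ rfl).symm⟩

theorem achievable_DV_iff {k : ℕ} (h : d.Represents .electionLimit (.electionLimit e k)) :
    Achievable plurality .DV (.electionLimit e k) p S ↔
      ∃ L ∈ d.outcomes p .DV, S = L.toFinset := by
  obtain ⟨hc, hv, rfl⟩ := h
  simp only [Achievable, ListInput.outcomes, List.mem_map, List.mem_filter, decide_eq_true_eq]
  constructor
  · rintro ⟨V', hV', hk, rfl⟩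
    obtain ⟨x, hx, rfl, h⟩ := WeightedVotes.le_expand_iff.1 (hv ▸ hV')
    rw [WeightedVotes.card_expand] at hk
    exact ⟨_, ⟨x, ⟨hx, hk⟩, rfl⟩, plurality_winners (by rw [← h, ← hv]; rfl) hc⟩
  · rintro ⟨_, ⟨x, ⟨hx, hk⟩, rfl⟩, rfl⟩
    have h := WeightedVotes.add_eq_expand_iff.2 ⟨x, hx, rfl, rfl⟩
    refine ⟨x.1.expand, ?_, by rwa [WeightedVotes.card_expand],
      (plurality_winners (e := e.deleteVotes x.1.expand) ?_ hc).symm⟩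
    · rw [hv, ← h]
      exact Multiset.le_add_right _ _
    · change e.votes - _ = _
      rw [hv, ← h, add_tsub_cancel_left]

theorem achievable_PV_iff {t : TieRule} (hn : d.cands.Nodup)
    (h : d.Represents .election (.election e)) :
    Achievable plurality (.PV t) (.election e) p S ↔
      ∃ L ∈ d.outcomes p (.PV t), S = L.toFinset := by
  obtain ⟨hc, hv⟩ := h
  simp only [Achievable, ListInput.outcomes, List.mem_map]
  have key (e₁ e₂ : Election) (h₁ : e₁.cands = e.cands) (h₂ : e₂.cands = e.cands)
      (x : WeightedVotes × WeightedVotes) (hx₁ : e₁.votes = x.1.expand)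
      (hx₂ : e₂.votes = x.2.expand) :
      plurality.winners (e.restrict (plurality.survivors t e₁ ∪ plurality.survivors t e₂)) =
        (d.votes.winners (t.surviving (x.1.winners d.cands) ++
          t.surviving (x.2.winners d.cands))).toFinset := by
    have hs (V : WeightedVotes) : (t.surviving (V.winners d.cands)).toFinset ⊆ e.cands :=
      fun c hc' => hc ▸ List.mem_toFinset.2
        (V.winners_subset _ (t.surviving_subset _ (List.mem_toFinset.1 hc')))
    rw [ElectionSystem.survivors_eq (x.1.nodup_winners hn) (plurality_winners hx₁ (h₁.trans hc)),
      ElectionSystem.survivors_eq (x.2.nodup_winners hn) (plurality_winners hx₂ (h₂.trans hc))]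
    exact plurality_winners_restrict hv List.toFinset_append.symm
      (Finset.union_subset (hs _) (hs _))
  constructor
  · rintro ⟨e₁, e₂, h₁, h₂, h, rfl⟩
    obtain ⟨x, hx, hx₁, hx₂⟩ := WeightedVotes.add_eq_expand_iff.1 (h.trans hv)
    exact ⟨_, ⟨x, hx, rfl⟩, key e₁ e₂ h₁ h₂ x hx₁ hx₂⟩
  · rintro ⟨_, ⟨x, hx, rfl⟩, rfl⟩
    have h := (WeightedVotes.add_eq_expand_iff.2 ⟨x, hx, rfl, rfl⟩).trans hv.symm
    let e₁ : Election :=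
      ⟨e.cands, x.1.expand, fun v hv' => e.isProfile v (h ▸ Multiset.mem_add.2 (.inl hv'))⟩
    let e₂ : Election :=
      ⟨e.cands, x.2.expand, fun v hv' => e.isProfile v (h ▸ Multiset.mem_add.2 (.inr hv'))⟩
    exact ⟨e₁, e₂, rfl, rfl, h, (key e₁ e₂ rfl rfl x rfl rfl).symm⟩

/-- The survivors of the subelection on a subset of the candidates. -/
theorem survivors_restrict_eq (h : d.Represents .election (.election e)) {L : List Candidate}
    (hL : L.Nodup) (hs : L ⊆ d.cands) (t : TieRule) :
    plurality.survivors t (e.restrict L.toFinset) =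
      (t.surviving (d.votes.winners L)).toFinset := by
  refine ElectionSystem.survivors_eq (WeightedVotes.nodup_winners _ hL) ?_ t
  exact plurality_winners_restrict h.2 rfl
    fun c hc => h.1 ▸ List.mem_toFinset.2 (hs (List.mem_toFinset.1 hc))

theorem achievable_PC_iff {t : TieRule} (hn : d.cands.Nodup)
    (h : d.Represents .election (.election e)) :
    Achievable plurality (.PC t) (.election e) p S ↔
      ∃ L ∈ d.outcomes p (.PC t), S = L.toFinset := by
  have key (L : List Candidate) (hL : L ∈ d.cands.sublists) :
      plurality.winners (e.restrict (plurality.survivors t (e.restrict L.toFinset) ∪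
        (complementIn d.cands L).toFinset)) = (d.votes.winners
          (t.surviving (d.votes.winners L) ++ complementIn d.cands L)).toFinset := by
    have hL' := List.mem_sublists.1 hL
    rw [survivors_restrict_eq h (hn.sublist hL') hL'.subset]
    refine plurality_winners_restrict h.2 List.toFinset_append.symm (Finset.union_subset ?_ ?_)
    · rw [← survivors_restrict_eq h (hn.sublist hL') hL'.subset, h.1]
      exact (plurality.survivors_restrict_subset _ _ _).trans (subset_toFinset_iff.2 ⟨L, hL, rfl⟩)
    · rw [toFinset_complementIn, h.1]
      exact Finset.sdiff_subset
  simp only [Achievable, ListInput.outcomes, List.mem_map, h.1, exists_partition_iff]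
  constructor
  · rintro ⟨L, hL, rfl⟩
    exact ⟨_, ⟨L, hL, rfl⟩, key L hL⟩
  · rintro ⟨_, ⟨L, hL, rfl⟩, rfl⟩
    exact ⟨L, hL, (key L hL).symm⟩

theorem achievable_RPC_iff {t : TieRule} (hn : d.cands.Nodup)
    (h : d.Represents .election (.election e)) :
    Achievable plurality (.RPC t) (.election e) p S ↔
      ∃ L ∈ d.outcomes p (.RPC t), S = L.toFinset := by
  have hs (L : List Candidate) (hL : L ⊆ d.cands) :
      (t.surviving (d.votes.winners L)).toFinset ⊆ e.cands := fun c hc =>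
    h.1 ▸ List.mem_toFinset.2
      (hL (WeightedVotes.winners_subset _ _ (t.surviving_subset _ (List.mem_toFinset.1 hc))))
  have key (L : List Candidate) (hL : L ∈ d.cands.sublists) :
      plurality.winners (e.restrict (plurality.survivors t (e.restrict L.toFinset) ∪
        plurality.survivors t (e.restrict (complementIn d.cands L).toFinset))) =
        (d.votes.winners (t.surviving (d.votes.winners L) ++
          t.surviving (d.votes.winners (complementIn d.cands L)))).toFinset := by
    have hL' := List.mem_sublists.1 hL
    have hR : List.Sublist (complementIn d.cands L) d.cands := List.filter_sublist
    rw [survivors_restrict_eq h (hn.sublist hL') hL'.subset,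
      survivors_restrict_eq h (hn.sublist hR) hR.subset]
    exact plurality_winners_restrict h.2 List.toFinset_append.symm
      (Finset.union_subset (hs _ hL'.subset) (hs _ hR.subset))
  simp only [Achievable, ListInput.outcomes, List.mem_map, h.1, exists_partition_iff]
  constructor
  · rintro ⟨L, hL, rfl⟩
    exact ⟨_, ⟨L, hL, rfl⟩, key L hL⟩
  · rintro ⟨_, ⟨L, hL, rfl⟩, rfl⟩
    exact ⟨L, hL, (key L hL).symm⟩

end

theorem achievable_iff {d : ListInput} (hn : d.cands.Nodup) {a : ControlAction} {I : ReducedInput}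
    (h : d.Represents a.inputKind I) (p : Candidate) (S : Finset Candidate) :
    Achievable plurality a I p S ↔ ∃ L ∈ d.outcomes p a, S = L.toFinset := by
  match a, I, h with
  | .AC, .spoilerCandidatesLimit _ _, h => exact achievable_AC_iff h
  | .UAC, .spoilerCandidates _, h => exact achievable_UAC_iff h
  | .DC, .electionLimit _ _, h => exact achievable_DC_iff h
  | .AV, .spoilerVotesLimit _ _ _ _, h => exact achievable_AV_iff h
  | .DV, .electionLimit _ _, h => exact achievable_DV_iff h
  | .PV _, .election _, h => exact achievable_PV_iff hn h
  | .PC _, .election _, h => exact achievable_PC_iff hn h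
  | .RPC _, .election _, h => exact achievable_RPC_iff hn h

/-- Whether the winner set `L` meets the goal of the control type for `p`. -/
def metBool (T : ControlType) (p : Candidate) (L : List Candidate) : Bool :=
  let wins := match T.model with
    | .UW => decide (p ∈ L) && L.all fun c => decide (c = p)
    | .NUW => decide (p ∈ L)
  match T.goal with
  | .CC => wins
  | .DC => !wins

theorem metBool_iff (T : ControlType) (p : Candidate) (L : List Candidate) :
    metBool T p L = true ↔ T.goal.Met T.model p L.toFinset := by
  have hu : L.toFinset = {p} ↔ p ∈ L ∧ ∀ c ∈ L, c = p := by
    rw [Finset.eq_singleton_iff_unique_mem]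
    simp
  obtain ⟨g, a, m⟩ := T
  cases g <;> cases m <;> simp [metBool, Goal.Met, WinnerModel.Wins, hu, imp_iff_not_or]

/-- Whether `p` belongs to the candidates of the input and control of type `T` succeeds for it under
plurality. -/
def ListInput.yes (d : ListInput) (p : Candidate) (T : ControlType) : Bool :=
  decide (p ∈ d.cands) && (d.outcomes p T.action).any (metBool T p)

theorem ListInput.Represents.cands_eq {d : ListInput} {κ : InputKind} {I : ReducedInput}
    (h : d.Represents κ I) : I.cands = d.cands.toFinset := by
  cases κ <;> cases I <;> first | exact h.1 | exact h.elim

theorem mem_yesInstances_iff {d : ListInput} (hn : d.cands.Nodup) {T : ControlType}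
    {I : ReducedInput} (h : d.Represents T.action.inputKind I) (p : Candidate) :
    (I, p) ∈ yesInstances plurality T ↔ d.yes p T = true := by
  simp only [yesInstances, Set.mem_ofPred_eq, achievable_iff hn h, h.cands_eq, ListInput.yes,
    Bool.and_eq_true, decide_eq_true_eq, List.any_eq_true, metBool_iff, List.mem_toFinset]
  refine and_congr_right fun _ => ⟨?_, ?_⟩
  · rintro ⟨_, ⟨L, hL, rfl⟩, hm⟩
    exact ⟨L, hL, hm⟩
  · rintro ⟨L, hL, hm⟩
    exact ⟨_, ⟨L, hL, rfl⟩, hm⟩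

/-! ### Decidability of the classification -/

instance : Fintype ControlAction :=
  ⟨{.AC, .UAC, .DC, .AV, .DV, .PV .TE, .PV .TP, .PC .TE, .PC .TP, .RPC .TE, .RPC .TP}, by
    rintro (_ | _ | _ | _ | _ | (_ | _) | (_ | _) | (_ | _)) <;> decide⟩

instance : Fintype Goal := ⟨{.CC, .DC}, by rintro (_ | _) <;> decide⟩

instance : Fintype WinnerModel := ⟨{.UW, .NUW}, by rintro (_ | _) <;> decide⟩

instance : Fintype ControlType :=
  Fintype.ofEquiv (Goal × ControlAction × WinnerModel)
    ⟨fun x => ⟨x.1, x.2.1, x.2.2⟩, fun T => ⟨T.goal, T.action, T.model⟩, fun _ => rfl, fun _ => rfl⟩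

instance : DecidableRel Compatible := fun T T' =>
  inferInstanceAs (Decidable (T.action.inputKind = T'.action.inputKind))

/-- The quantifiers over actions and winner models are resolved by reading these off `T` and `T'`. -/
theorem listedStrict_iff {T T' : ControlType} : ListedStrict T T' ↔
    (T.goal = .CC ∧ T.model = .UW ∧ T' = ⟨.CC, T.action, .NUW⟩) ∨
    (T.goal = .DC ∧ T.model = .NUW ∧ T.action ≠ .RPC .TE ∧ T.action ≠ .PC .TE ∧
      T' = ⟨.DC, T.action, .UW⟩) ∨
    ((T = ⟨.DC, .RPC .TP, .NUW⟩ ∨ T = ⟨.DC, .PC .TP, .NUW⟩) ∧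
      (T' = ⟨.DC, .RPC .TP, .UW⟩ ∨ T' = ⟨.DC, .PC .TP, .UW⟩)) ∨
    ((T = ⟨.DC, .RPC .TP, T.model⟩ ∨ T = ⟨.DC, .PC .TP, T.model⟩) ∧
      (T' = ⟨.DC, .RPC .TE, T'.model⟩ ∨ T' = ⟨.DC, .PC .TE, T'.model⟩)) := by
  refine or_congr ⟨?_, ?_⟩ (or_congr ⟨?_, ?_⟩ (or_congr_right ⟨?_, fun h => ⟨_, _, h⟩⟩))
  · rintro ⟨a, rfl, rfl⟩
    exact ⟨rfl, rfl, rfl⟩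
  · obtain ⟨g, a, m⟩ := T
    rintro ⟨rfl, rfl, rfl⟩
    exact ⟨a, rfl, rfl⟩
  · rintro ⟨a, h₁, h₂, rfl, rfl⟩
    exact ⟨rfl, rfl, h₁, h₂, rfl⟩
  · obtain ⟨g, a, m⟩ := T
    rintro ⟨rfl, rfl, h₁, h₂, rfl⟩
    exact ⟨a, h₁, h₂, rfl, rfl⟩
  · rintro ⟨m, m', rfl | rfl, rfl | rfl⟩ <;> simp

instance : DecidableRel ListedStrict := fun _ _ => decidable_of_iff' _ listedStrict_iff

instance (z : Sym2 ControlType) : Decidable (z ∈ sevenCollapses) := by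
  unfold sevenCollapses
  infer_instance

/-! ### Separations under plurality -/

/-- Inputs of each kind on which the control types of that kind differ under plurality; the focus
candidate is `0` throughout. For a kind that belongs to a single action, three inputs suffice: one on
which `0` is the unique winner however control is exercised, one on which it always loses, and one on
which it always wins but never alone. The inputs of the other two kinds were selected by a search
over small elections, so that together they separate all pairs in `exists_separatingInput`. -/
def separatingInputs : InputKind → List ListInput
  | .spoilerCandidates | .spoilerCandidatesLimit =>
    [⟨[0, 1], [2], [([0, 1, 2], 1)], [], 1⟩,
      ⟨[0, 1], [2], [([2, 1, 0], 1)], [], 1⟩,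
      ⟨[0, 1], [2], [([0, 1, 2], 1), ([2, 1, 0], 1)], [], 1⟩]
  | .spoilerVotesLimit =>
    [⟨[0, 1], [], [([0, 1], 2)], [([1, 0], 1)], 1⟩,
      ⟨[0, 1], [], [([1, 0], 2)], [([0, 1], 1)], 1⟩,
      ⟨[0, 1, 2], [], [([0, 1, 2], 1), ([1, 0, 2], 1)], [([2, 0, 1], 1)], 1⟩]
  | .electionLimit =>
    [⟨[0, 1], [], [([1, 0], 1)], [], 0⟩,
      ⟨[0, 1], [], [], [], 0⟩,
      ⟨[0, 1], [], [([1, 0], 2)], [], 1⟩,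
      ⟨[0, 1], [], [([0, 1], 2), ([1, 0], 1)], [], 2⟩,
      ⟨[0, 1, 2, 3], [], [([1, 2, 3, 0], 2), ([0, 3, 2, 1], 1)], [], 2⟩,
      ⟨[0, 1, 2], [], [([0, 2, 1], 2), ([1, 2, 0], 2), ([0, 1, 2], 1), ([2, 0, 1], 1),
        ([2, 1, 0], 1)], [], 1⟩,
      ⟨[0, 1, 2], [], [([0, 1, 2], 5), ([1, 2, 0], 3), ([2, 1, 0], 3)], [], 1⟩]
  | .election =>
    [⟨[0, 1], [], [([0, 1], 1), ([1, 0], 1)], [], 0⟩,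
      ⟨[0, 1, 2], [], [([0, 2, 1], 2), ([1, 2, 0], 3), ([2, 0, 1], 2)], [], 0⟩,
      ⟨[0, 1, 2], [], [([0, 1, 2], 4), ([1, 0, 2], 3), ([2, 0, 1], 3)], [], 0⟩,
      ⟨[0, 1, 2], [], [([0, 1, 2], 2), ([1, 0, 2], 2), ([2, 0, 1], 1)], [], 0⟩,
      ⟨[0, 1, 2, 3], [], [([0, 1, 2, 3], 2), ([2, 3, 0, 1], 2), ([3, 1, 0, 2], 3)], [], 0⟩,
      ⟨[0, 1, 2, 3], [], [([0, 2, 3, 1], 3), ([1, 2, 0, 3], 2), ([3, 2, 0, 1], 2)], [], 0⟩,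
      ⟨[0, 1, 2, 3], [], [([0, 2, 3, 1], 3), ([1, 2, 3, 0], 1), ([2, 1, 3, 0], 1),
        ([3, 1, 2, 0], 1)], [], 0⟩,
      ⟨[0, 1, 2, 3, 4], [], [([1, 2, 3, 4, 0], 1), ([2, 3, 1, 4, 0], 1), ([3, 2, 0, 4, 1], 2),
        ([4, 0, 3, 1, 2], 3)], [], 0⟩,
      ⟨[0, 1, 2, 3, 4], [], [([0, 1, 2, 3, 4], 1), ([0, 4, 1, 3, 2], 4), ([1, 2, 0, 3, 4], 2),
        ([2, 4, 3, 1, 0], 2), ([3, 4, 0, 2, 1], 2), ([4, 0, 1, 3, 2], 2)], [], 0⟩,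
      ⟨[0, 1, 2, 3, 4], [], [([0, 4, 3, 1, 2], 1), ([1, 0, 2, 3, 4], 2), ([2, 3, 1, 4, 0], 1),
        ([3, 1, 4, 2, 0], 2), ([4, 1, 2, 3, 0], 2)], [], 0⟩,
      ⟨[0, 1, 2, 3, 4], [], [([0, 2, 4, 3, 1], 1), ([1, 2, 3, 0, 4], 3), ([2, 4, 0, 1, 3], 2),
        ([3, 4, 1, 0, 2], 2), ([4, 0, 3, 1, 2], 1)], [], 0⟩,
      ⟨[0, 1, 2, 3, 4], [], [([0, 2, 1, 4, 3], 2), ([0, 3, 4, 2, 1], 1), ([1, 2, 0, 3, 4], 1),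
        ([2, 4, 3, 1, 0], 1), ([3, 1, 4, 0, 2], 1), ([3, 2, 4, 0, 1], 1)], [], 0⟩]

theorem separatingInputs_valid (κ : InputKind) : ∀ d ∈ separatingInputs κ, d.Valid κ := by
  cases κ <;> decide +kernel

/-- Outside the collapses and the listed containments, each ordered pair of compatible types is
separated, in the direction refuting containment, by one of the chosen inputs. -/
theorem exists_separatingInput : ∀ T T' : ControlType, T ≠ T' → Compatible T T' →
    s(T, T') ∉ sevenCollapses → ¬ ListedStrict T T' →
      ∃ d ∈ separatingInputs T.action.inputKind, d.yes 0 T = true ∧ d.yes 0 T' = false := by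
  decide +kernel

/-! ### Classification of the compatible pairs -/

/-- Under plurality no containment holds apart from the collapses and the listed containments. -/
theorem separates_of_not_listed {T T' : ControlType} (hne : T ≠ T') (hc : Compatible T T')
    (h₁ : s(T, T') ∉ sevenCollapses) (h₂ : ¬ ListedStrict T T') :
    ∃ I, (controlFun plurality T I \ controlFun plurality T' I).Nonempty := by
  obtain ⟨d, hd, hy, hn⟩ := exists_separatingInput T T' hne hc h₁ h₂
  have hv := separatingInputs_valid _ d hd
  obtain ⟨I, hI⟩ := hv.exists_represents
  have hnd : d.cands.Nodup := hv.nodup.of_append_left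
  refine ⟨I, 0, (mem_yesInstances_iff hnd hI 0).2 hy, fun h => ?_⟩
  have hI' : d.Represents T'.action.inputKind I := by
    unfold Compatible at hc
    exact hc ▸ hI
  rw [(mem_yesInstances_iff hnd hI' 0).1 h] at hn
  exact absurd hn (by decide)

theorem not_containedFor_of_nonempty {E : ElectionSystem} {T T' : ControlType}
    (h : ∃ I, (controlFun E T I \ controlFun E T' I).Nonempty) : ¬ ContainedFor E T T' := by
  obtain ⟨I, c, h₁, h₂⟩ := h
  exact fun hc => h₂ (hc I h₁)

theorem separateFor_of_not_containedFor {E : ElectionSystem} {T T' : ControlType}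
    (h : ¬ ContainedFor E T T') : SeparateFor E T T' :=
  fun he => h (containedFor_iff.2 he.subset)

theorem ListedStrict.asymm : ∀ T T' : ControlType, ListedStrict T T' → ¬ ListedStrict T' T := by
  decide +kernel

theorem ListedStrict.not_mem_sevenCollapses :
    ∀ T T' : ControlType, ListedStrict T T' → s(T, T') ∉ sevenCollapses := by
  decide +kernel

theorem ListedStrict.ne_and_compatible :
    ∀ T T' : ControlType, ListedStrict T T' → T ≠ T' ∧ Compatible T T' := by
  decide +kernel

theorem ne_and_compatible_of_mem_sevenCollapses :
    ∀ T T' : ControlType, s(T, T') ∈ sevenCollapses → T ≠ T' ∧ Compatible T T' := by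
  decide +kernel

section
variable {T T' : ControlType}

/-- Plurality separates every compatible pair that does not collapse: at least one of the two
containments is not listed, since the list is asymmetric. -/
theorem separateFor_plurality (hne : T ≠ T') (hc : Compatible T T')
    (h : s(T, T') ∉ sevenCollapses) : SeparateFor plurality T T' := by
  by_cases hl : ListedStrict T T'
  · have h' : s(T', T) ∉ sevenCollapses := Sym2.eq_swap ▸ h
    exact (separateFor_of_not_containedFor (not_containedFor_of_nonempty
      (separates_of_not_listed hne.symm hc.symm h' (ListedStrict.asymm _ _ hl)))).symm
  · exact separateFor_of_not_containedFor
      (not_containedFor_of_nonempty (separates_of_not_listed hne hc h hl))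

theorem ListedStrict.strictlyContainedFor_plurality (h : ListedStrict T T') :
    StrictlyContainedFor plurality T T' := by
  obtain ⟨hne, hc⟩ := ListedStrict.ne_and_compatible _ _ h
  have h' : s(T', T) ∉ sevenCollapses :=
    Sym2.eq_swap ▸ ListedStrict.not_mem_sevenCollapses _ _ h
  exact ⟨h.containedFor _,
    separates_of_not_listed hne.symm hc.symm h' (ListedStrict.asymm _ _ h)⟩

theorem incomparableFor_plurality (hne : T ≠ T') (hc : Compatible T T')
    (h : s(T, T') ∉ sevenCollapses) (h₁ : ¬ ListedStrict T T') (h₂ : ¬ ListedStrict T' T) :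
    IncomparableFor plurality T T' :=
  have h' : s(T', T) ∉ sevenCollapses := Sym2.eq_swap ▸ h
  ⟨separateFor_plurality hne hc h,
    fun hs => not_containedFor_of_nonempty (separates_of_not_listed hne hc h h₁) hs.1,
    fun hs => not_containedFor_of_nonempty
      (separates_of_not_listed hne.symm hc.symm h' h₂) hs.1⟩

theorem generalCollapse_iff (hne : T ≠ T') (hc : Compatible T T') :
    GeneralCollapse T T' ↔ s(T, T') ∈ sevenCollapses := by
  refine ⟨fun h => ?_, fun h E => collapseFor_of_mem_sevenCollapses h E⟩
  by_contra hn
  exact separateFor_plurality hne hc hn (h plurality)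

theorem generalStrictlyContained_iff (hne : T ≠ T') (hc : Compatible T T') :
    GeneralStrictlyContained T T' ↔ ListedStrict T T' := by
  constructor
  · rintro ⟨h, E, I, hI⟩
    by_contra hl
    by_cases hs : s(T, T') ∈ sevenCollapses
    · have := collapseFor_of_mem_sevenCollapses hs E
      exact not_containedFor_of_nonempty ⟨I, hI⟩ (containedFor_iff.2 this.symm.subset)
    · exact not_containedFor_of_nonempty (separates_of_not_listed hne hc hs hl) (h plurality)
  · intro h
    exact ⟨h.containedFor, plurality, h.strictlyContainedFor_plurality.2⟩

/-- Where containment holds without equality, it is strict. -/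
theorem strictlyContainedFor_of_containedFor {E : ElectionSystem} (h : ContainedFor E T T')
    (hs : SeparateFor E T T') : StrictlyContainedFor E T T' := by
  refine ⟨h, ?_⟩
  by_contra hn
  refine hs (Set.Subset.antisymm (containedFor_iff.1 h) fun x hx => ?_)
  by_contra hx'
  exact hn ⟨x.1, x.2, hx, hx'⟩

theorem generalIncomparable_iff (hne : T ≠ T') (hc : Compatible T T') :
    GeneralIncomparable T T' ↔
      s(T, T') ∉ sevenCollapses ∧ ¬ ListedStrict T T' ∧ ¬ ListedStrict T' T := by
  constructor
  · rintro ⟨E, hs, h₁, h₂⟩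
    exact ⟨fun h => hs (collapseFor_of_mem_sevenCollapses h E),
      fun h => h₁ (strictlyContainedFor_of_containedFor (h.containedFor E) hs),
      fun h => h₂ (strictlyContainedFor_of_containedFor (h.containedFor E) hs.symm)⟩
  · rintro ⟨h, h₁, h₂⟩
    exact ⟨plurality, incomparableFor_plurality hne hc h h₁ h₂⟩

end

/-! ### Counting pairs -/

theorem compatiblePairs_congr {R r : ControlType → ControlType → Prop}
    (h : ∀ T T', T ≠ T' → Compatible T T' → (R T T' ↔ r T T')) :
    compatiblePairs R = compatiblePairs r := by
  ext z
  constructor <;> rintro ⟨T, T', rfl, hne, hc, hR⟩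
  exacts [⟨T, T', rfl, hne, hc, (h T T' hne hc).1 hR⟩, ⟨T, T', rfl, hne, hc, (h T T' hne hc).2 hR⟩]

/-- The pairs of compatible types in the relation `r` are the edges of a graph on the control types,
so twice their number is the number of adjacent ordered pairs. -/
theorem ncard_compatiblePairs (r : ControlType → ControlType → Prop) [DecidableRel r] {n : ℕ}
    (hn : (Finset.univ.filter fun x : ControlType × ControlType =>
      x.1 ≠ x.2 ∧ Compatible x.1 x.2 ∧ (r x.1 x.2 ∨ r x.2 x.1)).card = 2 * n) :
    (compatiblePairs r).ncard = n := by
  classical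
  let G := SimpleGraph.fromRel fun T T' => Compatible T T' ∧ r T T'
  have hG : compatiblePairs r = G.edgeFinset := by
    ext z
    induction z with | _ T T' => ?_
    rw [SimpleGraph.coe_edgeFinset, SimpleGraph.mem_edgeSet, SimpleGraph.fromRel_adj]
    constructor
    · rintro ⟨A, B, h, hne, hc, hr⟩
      rcases Sym2.eq_iff.1 h with ⟨rfl, rfl⟩ | ⟨rfl, rfl⟩
      exacts [⟨hne, .inl ⟨hc, hr⟩⟩, ⟨hne.symm, .inr ⟨hc, hr⟩⟩]
    · rintro ⟨hne, ⟨hc, hr⟩ | ⟨hc, hr⟩⟩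
      exacts [⟨T, T', rfl, hne, hc, hr⟩, ⟨T', T, Sym2.eq_swap, hne.symm, hc, hr⟩]
  rw [hG, Set.ncard_coe_finset]
  refine Nat.eq_of_mul_eq_mul_left two_pos (G.two_mul_card_edgeFinset.trans ?_)
  rw [← hn]
  congr 1
  ext ⟨T, T'⟩
  have : Compatible T' T ↔ Compatible T T' := eq_comm
  simp only [Finset.mem_filter, Finset.mem_univ, true_and, G, SimpleGraph.fromRel_adj, this]
  tauto

/-! ### Neutrality of plurality, and the classification -/

theorem plurality_neutral : plurality.Neutral := by
  intro σ e
  have hs (c : Candidate) : (e.relabel σ).pluralityScore (σ c) = e.pluralityScore c := by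
    change (e.votes.map _).countP _ = _
    rw [Multiset.countP_map, ← Multiset.countP_eq_card_filter]
    refine Multiset.countP_congr rfl fun v _ => ?_
    simp [List.head?_map]
  have hm (c : Candidate) : c ∈ (e.relabel σ).cands ↔ σ.symm c ∈ e.cands := by
    change c ∈ e.cands.map σ.toEmbedding ↔ _
    exact Finset.mem_map_equiv
  ext c
  rw [Finset.mem_map_equiv]
  obtain ⟨c, rfl⟩ := σ.surjective c
  simp only [plurality, Finset.mem_filter, hm, Equiv.symm_apply_apply, hs]
  refine and_congr_right fun _ => ⟨fun h d hd => ?_, fun h d hd => ?_⟩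
  · have := h (σ d) (by simpa using hd)
    rwa [hs] at this
  · obtain ⟨d, rfl⟩ := σ.surjective d
    rw [hs]
    exact h d (by simpa using hd)

theorem mainTheorem1 :
    -- The 44 control types form 322 compatible pairs.
    Nat.card ControlType = 44 ∧
    (compatiblePairs (fun _ _ => True)).ncard = 322 ∧
    -- Exactly seven of these pairs collapse for all election systems; the other 315 separate.
    compatiblePairs GeneralCollapse = sevenCollapses ∧
    (compatiblePairs GeneralCollapse).ncard = 7 ∧
    (compatiblePairs GeneralSeparate).ncard = 315 ∧
    -- Classification of the separations: 38 strict containments, 277 incomparable pairs.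
    (∀ T T' : ControlType, T ≠ T' → Compatible T T' →
      (GeneralStrictlyContained T T' ↔ ListedStrict T T') ∧
      (GeneralIncomparable T T' ↔
        s(T, T') ∉ sevenCollapses ∧ ¬ ListedStrict T T' ∧ ¬ ListedStrict T' T)) ∧
    (compatiblePairs GeneralStrictlyContained).ncard = 38 ∧
    (compatiblePairs GeneralIncomparable).ncard = 277 ∧
    -- Plurality, a candidate-neutral system, witnesses each separation and its kind.
    plurality.Neutral ∧
    (∀ T T' : ControlType, T ≠ T' → Compatible T T' →
      (GeneralSeparate T T' → SeparateFor plurality T T') ∧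
      (GeneralStrictlyContained T T' → StrictlyContainedFor plurality T T') ∧
      (GeneralIncomparable T T' → IncomparableFor plurality T T')) := by
  have hcollapse : compatiblePairs GeneralCollapse =
      compatiblePairs fun T T' => s(T, T') ∈ sevenCollapses :=
    compatiblePairs_congr fun _ _ => generalCollapse_iff
  refine ⟨?_, ?_, ?_, ?_, ?_, fun T T' hne hc =>
    ⟨generalStrictlyContained_iff hne hc, generalIncomparable_iff hne hc⟩, ?_, ?_,
    plurality_neutral, fun T T' hne hc => ⟨fun h => ?_, fun h => ?_, fun h => ?_⟩⟩
  · rw [Nat.card_eq_fintype_card]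
    decide +kernel
  · exact ncard_compatiblePairs _ (by decide +kernel)
  · rw [hcollapse]
    ext z
    induction z with | _ T T' => ?_
    constructor
    · rintro ⟨A, B, h, -, -, hR⟩
      exact h ▸ hR
    · intro h
      obtain ⟨hne, hc⟩ := ne_and_compatible_of_mem_sevenCollapses _ _ h
      exact ⟨T, T', rfl, hne, hc, h⟩
  · rw [hcollapse]
    exact ncard_compatiblePairs _ (by decide +kernel)
  · rw [compatiblePairs_congr (R := GeneralSeparate) (r := fun T T' => s(T, T') ∉ sevenCollapses)
      fun _ _ hne hc => not_congr (generalCollapse_iff hne hc)]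
    exact ncard_compatiblePairs _ (by decide +kernel)
  · rw [compatiblePairs_congr fun _ _ => generalStrictlyContained_iff]
    exact ncard_compatiblePairs _ (by decide +kernel)
  · rw [compatiblePairs_congr fun _ _ => generalIncomparable_iff]
    exact ncard_compatiblePairs _ (by decide +kernel)
  · exact separateFor_plurality hne hc fun hs => h ((generalCollapse_iff hne hc).2 hs)
  · exact ((generalStrictlyContained_iff hne hc).1 h).strictlyContainedFor_plurality
  · obtain ⟨hs, h₁, h₂⟩ := (generalIncomparable_iff hne hc).1 h
    exact incomparableFor_plurality hne hc hs h₁ h₂
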